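/- Let $\Sigma$ be a finite alphabet containing two distinct letters $a,b$. For a language $L\subseteq\Sigma^*$ let $\sigma(L)$ (the syntactic complexity of $L$) be the cardinality of the syntactic semigroup $\Sigma^+/{\approx_L}$, where $u\approx_L v$ if and only if for all $x,y\in\Sigma^*$ one has $xuy\in L\Leftrightarrow xvy\in L$. (1) For every word $u\in\Sigma^*$ of length $n$, $$n^2\le\sigma(\Sigma^*u\Sigma^*)\le 1.5\,n^2+o(n^2),$$ where the $o(n^2)$ term depends only on $\Sigma$ and $n$, and not on $u$. (2) The upper bound is asymptotically attained: for every $n\ge 0$ (in particular for every $n\ge 21$) there is a word $w_n$ of length $n$ such that $$\sigma(\Sigma^*w_n\Sigma^*)=1.5\,n^2+o(n^2)\qquad(n\to\infty).$$ Explicitly, one may take, for every even $k\ge 0$: - $w_n=ab^2a^3b^4\cdots a^{k-1}b^k$ if $n=1+2+\cdots+k$; - $w_n=ab^2a^3b^4\cdots a^{k-1}b^k\,a^l$ if $n=(1+2+\cdots+k)+l$ with $1\le l\le k+1$; - $w_n=ab^2a^3b^4\cdots a^{k-1}b^k\,a^{k+1}b^r$ if $n=(1+2+\cdots+(k+1))+r$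 with $1\le r\le k+1$. (For $k=0$ the block word $ab^2a^3b^4\cdots a^{k-1}b^k$ is the empty word.) -/

import Mathlib

open Filter Asymptotics

/-- The nonempty word over `α` represented by an element of the free semigroup `Σ⁺`. -/
def FreeSemigroup.letters {α : Type*} (u : FreeSemigroup α) : List α :=
  u.head :: u.tail

theorem FreeSemigroup.letters_mul {α : Type*} (u v : FreeSemigroup α) :
    (u * v).letters = u.letters ++ v.letters := rfl

/-- The syntactic (Myhill) congruence of a language `L`, on the semigroup `Σ⁺` of nonempty words:
`u ≈ v` iff `xuy ∈ L ↔ xvy ∈ L` for all (possibly empty) words `x, y`. -/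
def syntacticCongruence {α : Type*} (L : Language α) : Con (FreeSemigroup α) where
  r u v := ∀ x y : List α, x ++ u.letters ++ y ∈ L ↔ x ++ v.letters ++ y ∈ L
  iseqv :=
    { refl := fun _ _ _ => Iff.rfl
      symm := fun h x y => (h x y).symm
      trans := fun h₁ h₂ x y => (h₁ x y).trans (h₂ x y) }
  mul' := by
    intro u u' v v' hu hv x y
    have h₁ := hu x (v.letters ++ y)
    have h₂ := hv (x ++ u'.letters) y
    simp only [FreeSemigroup.letters_mul, List.append_assoc] at h₁ h₂ ⊢
    exact h₁.trans h₂

/-- The syntactic semigroup `Σ⁺/≈_L` of `L`. -/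
abbrev SyntacticSemigroup {α : Type*} (L : Language α) : Type _ :=
  (syntacticCongruence L).Quotient

/-- The syntactic complexity `σ(L)`: the cardinality of the syntactic semigroup of `L`. -/
noncomputable def syntacticComplexity {α : Type*} (L : Language α) : ℕ :=
  Nat.card (SyntacticSemigroup L)

/-- The principal ideal language `Σ*wΣ*`. -/
def principalIdealLanguage {α : Type*} (w : List α) : Language α :=
  (⊤ : Language α) * ({w} : Language α) * (⊤ : Language α)

/-- The word `a b² a³ b⁴ ⋯ x^k` with `k` alternating blocks, the `i`-th of length `i`
(so the last letter `x` is `b` if `k` is even and `a` if `k` is odd). -/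
def alternatingBlocks {α : Type*} (a b : α) : ℕ → List α
  | 0 => []
  | k + 1 => alternatingBlocks a b k ++ List.replicate (k + 1) (if Even k then a else b)

/-! ### Classes of `Σ*uΣ*`: overlaps, factors and the upper bound -/

section SyntacticEquivalence

variable {α : Type*} {u v v' x y : List α} {s p m : ℕ}

/-! Let `n = |u|`. Nonempty words fall into three kinds: those containing `u`, which form one class;
factors of `u`, of which there are at most `n(n+1)/2`; and the rest. A word `v` of the last kind
cannot lie inside an occurrence of `u` in `xvy`, so each such occurrence shows up in `xv` or in
`vy`, and the class of `v` depends only on its longest left and right overlaps with `u`, each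
smaller than `n` (`synEq_of_isMaxOverlap`). This gives the upper bound `n² + n(n+1)/2 + 1`.

Conversely, overlaps are invariants of classes of words not containing `u` (`SynEq.overlaps_eq`).
The pair `(|S|, |P|)` is realized by `S cⁿ dⁿ P`, with `S` a suffix and `P` a prefix of `u`, `c` not
its last letter and `d` not its first. This works for suitable `c, d` unless `u = h⋯he⋯e`, where the
words `SP` serve instead and `u` itself replaces the pair `(0, 0)`.

The words `w_n` are the prefixes of one infinite word `ab²a³b⁴⋯`. A factor of length beyond about
`2√(2n)` contains a complete block, which reveals its position (`eq_of_blockLetter_eq`). Hence `n²/2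
- O(n^{3/2})` factors are distinct and interior, and these lie in classes of their own, disjoint
from the `n²` padded ones (`sq_add_card_le_syntacticComplexity`). -/

theorem mem_principalIdealLanguage : v ∈ principalIdealLanguage u ↔ u <:+: v := by
  constructor
  · rintro ⟨_, ⟨x, -, _, rfl, rfl⟩, y, -, rfl⟩
    exact ⟨x, y, rfl⟩
  · rintro ⟨x, y, rfl⟩
    exact ⟨_, ⟨x, trivial, u, rfl, rfl⟩, y, trivial, rfl⟩

/-- Two words are syntactically equivalent with respect to the language `Σ*uΣ*`. -/
def SynEq (u v v' : List α) : Prop :=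
  ∀ x y : List α, u <:+: x ++ v ++ y ↔ u <:+: x ++ v' ++ y

theorem SynEq.symm (h : SynEq u v v') : SynEq u v' v := fun x y => (h x y).symm

theorem SynEq.infix_iff (h : SynEq u v v') : u <:+: v ↔ u <:+: v' := by
  simpa using h [] []

theorem SynEq.append_left_iff (h : SynEq u v v') (x : List α) :
    u <:+: x ++ v ↔ u <:+: x ++ v' := by
  simpa using h x []

theorem SynEq.append_right_iff (h : SynEq u v v') (y : List α) :
    u <:+: v ++ y ↔ u <:+: v' ++ y := by
  simpa using h [] y

theorem synEq_of_infix (hv : u <:+: v) (hv' : u <:+: v') : SynEq u v v' := fun x y =>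
  ⟨fun _ => hv'.trans (List.infix_append x v' y), fun _ => hv.trans (List.infix_append x v y)⟩

theorem syntacticCongruence_principalIdealLanguage_iff {v v' : FreeSemigroup α} :
    syntacticCongruence (principalIdealLanguage u) v v' ↔ SynEq u v.letters v'.letters := by
  change (∀ x y : List α, _ ↔ _) ↔ _
  simp only [mem_principalIdealLanguage, SynEq]

theorem FreeSemigroup.exists_letters_eq (hv : v ≠ []) :
    ∃ w : FreeSemigroup α, w.letters = v := by
  cases v with
  | nil => exact absurd rfl hv
  | cons c t => exact ⟨⟨c, t⟩, rfl⟩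

theorem FreeSemigroup.letters_ne_nil (v : FreeSemigroup α) : v.letters ≠ [] :=
  List.cons_ne_nil _ _

/-- If a finite-valued invariant separates the syntactic classes, then it bounds their number. -/
theorem finite_and_syntacticComplexity_le {T : Type*} [Fintype T] (g : List α → T)
    (hg : ∀ v v' : List α, v ≠ [] → v' ≠ [] → g v = g v' → SynEq u v v') :
    Finite (SyntacticSemigroup (principalIdealLanguage u)) ∧
      syntacticComplexity (principalIdealLanguage u) ≤ Fintype.card T := by
  have hinj : Function.Injective
      fun q : SyntacticSemigroup (principalIdealLanguage u) => g (Quotient.out q).letters := by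
    intro q q' h
    have h' := syntacticCongruence_principalIdealLanguage_iff.2
      (hg _ _ (FreeSemigroup.letters_ne_nil _) (FreeSemigroup.letters_ne_nil _) h)
    exact Quotient.out_equiv_out.1 h'
  refine ⟨Finite.of_injective _ hinj, ?_⟩
  rw [← Nat.card_eq_fintype_card]
  exact Nat.card_le_card_of_injective _ hinj

/-- A family of pairwise inequivalent nonempty words bounds the number of classes from below. -/
theorem card_le_syntacticComplexity {ι : Type*} [Fintype ι]
    [Finite (SyntacticSemigroup (principalIdealLanguage u))] (f : ι → List α)
    (hne : ∀ i, f i ≠ []) (hf : ∀ i j, SynEq u (f i) (f j) → i = j) :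
    Fintype.card ι ≤ syntacticComplexity (principalIdealLanguage u) := by
  choose w hw using fun i => FreeSemigroup.exists_letters_eq (hne i)
  rw [← Nat.card_eq_fintype_card]
  refine Nat.card_le_card_of_injective
    (fun i => ((w i : FreeSemigroup α) : SyntacticSemigroup (principalIdealLanguage u))) ?_
  intro i j h
  have h' := syntacticCongruence_principalIdealLanguage_iff.1 ((Con.eq _).1 h)
  rw [hw, hw] at h'
  exact hf i j h'

/-- An occurrence of `u` meeting both `x` and `y` would cover `v` entirely. -/
theorem infix_append_or_of_infix (hv : ¬ v <:+: u) (h : u <:+: x ++ v ++ y) :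
    u <:+: x ++ v ∨ u <:+: v ++ y := by
  rcases List.infix_append_iff.1 h with h | h | ⟨l₁, l₂, rfl, h₁, h₂⟩
  · exact Or.inl h
  · exact Or.inr (List.infix_append_of_infix_right h)
  · rcases List.suffix_or_suffix_of_suffix h₁ (List.suffix_append x v) with h | h
    · obtain ⟨t, rfl⟩ := h
      obtain ⟨t', rfl⟩ := h₂
      exact Or.inr ⟨t, t', by simp⟩
    · exact absurd (h.isInfix.trans List.infix_append_left) hv

theorem infix_append_append_iff (hv : ¬ v <:+: u) :
    u <:+: x ++ v ++ y ↔ u <:+: x ++ v ∨ u <:+: v ++ y := by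
  refine ⟨infix_append_or_of_infix hv, ?_⟩
  rintro (h | h)
  · exact List.infix_append_of_infix_left h
  · rw [List.append_assoc]
    exact List.infix_append_of_infix_right h

/-- `m` is the length of the longest word that is a suffix of `x` and a prefix of `y`. -/
def IsMaxOverlap (x y : List α) (m : ℕ) : Prop :=
  IsGreatest {k | ∃ l : List α, l.length = k ∧ l <:+ x ∧ l <+: y} m

theorem exists_isMaxOverlap (x y : List α) : ∃ m, IsMaxOverlap x y m := by
  have hne : {k | ∃ l : List α, l.length = k ∧ l <:+ x ∧ l <+: y}.Nonempty :=
    ⟨0, [], rfl, List.nil_suffix, List.nil_prefix⟩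
  have hbd : BddAbove {k | ∃ l : List α, l.length = k ∧ l <:+ x ∧ l <+: y} := by
    refine ⟨x.length, ?_⟩
    rintro _ ⟨l, rfl, h, -⟩
    exact h.length_le
  exact ⟨_, Nat.sSup_mem hne hbd, fun k hk => le_csSup hbd hk⟩

theorem IsMaxOverlap.lt_left (h : IsMaxOverlap u v s) (hv : ¬ u <:+: v) : s < u.length := by
  obtain ⟨⟨l, rfl, hu, hl⟩, -⟩ := h
  refine lt_of_le_of_ne hu.length_le fun e => hv ?_
  rw [← hu.eq_of_length e]
  exact hl.isInfix

theorem IsMaxOverlap.lt_right (h : IsMaxOverlap v u s) (hv : ¬ u <:+: v) : s < u.length := by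
  obtain ⟨⟨l, rfl, hl, hu⟩, -⟩ := h
  refine lt_of_le_of_ne hu.length_le fun e => hv ?_
  rw [← hu.eq_of_length e]
  exact hl.isInfix

theorem infix_append_left_of_isMaxOverlap (hv : ¬ u <:+: v) (h : IsMaxOverlap u v s)
    (h' : IsMaxOverlap u v' s) (x : List α) (hx : u <:+: x ++ v) : u <:+: x ++ v' := by
  rcases List.infix_append_iff.1 hx with hx | hx | ⟨l₁, l₂, e, h₁, h₂⟩
  · exact List.infix_append_of_infix_left hx
  · exact absurd hx hv
  · have hl₂ : l₂ <:+ u := e ▸ List.suffix_append _ _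
    have hle : l₂.length ≤ s := h.2 ⟨l₂, rfl, hl₂, h₂⟩
    obtain ⟨l, hl, hlu, hlv⟩ := h'.1
    have hl₂l : l₂ <:+ l := List.suffix_of_suffix_length_le hl₂ hlu (hl ▸ hle)
    obtain ⟨l₀, hl₀, hlu₀, hlv₀⟩ := h.1
    have : l₀ = l := List.IsSuffix.eq_of_length
      (List.suffix_of_suffix_length_le hlu₀ hlu (by omega)) (by omega)
    have h₃ : l₂ <+: v' :=
      (List.prefix_of_prefix_length_le h₂ hlv₀ (by omega)).trans (this ▸ hlv)
    exact List.infix_append_iff.2 (Or.inr (Or.inr ⟨l₁, l₂, e, h₁, h₃⟩))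

theorem infix_append_right_of_isMaxOverlap (hv : ¬ u <:+: v) (h : IsMaxOverlap v u s)
    (h' : IsMaxOverlap v' u s) (y : List α) (hy : u <:+: v ++ y) : u <:+: v' ++ y := by
  rcases List.infix_append_iff.1 hy with hy | hy | ⟨l₁, l₂, e, h₁, h₂⟩
  · exact absurd hy hv
  · exact List.infix_append_of_infix_right hy
  · have hl₁ : l₁ <+: u := e ▸ List.prefix_append _ _
    have hle : l₁.length ≤ s := h.2 ⟨l₁, rfl, h₁, hl₁⟩
    obtain ⟨l, hl, hlv, hlu⟩ := h'.1
    obtain ⟨l₀, hl₀, hlv₀, hlu₀⟩ := h.1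
    have : l₀ = l := List.IsPrefix.eq_of_length
      (List.prefix_of_prefix_length_le hlu₀ hlu (by omega)) (by omega)
    have h₃ : l₁ <:+ v' :=
      (List.suffix_of_suffix_length_le h₁ hlv₀ (by omega)).trans (this ▸ hlv)
    exact List.infix_append_iff.2 (Or.inr (Or.inr ⟨l₁, l₂, e, h₃, h₂⟩))

/-- The class of a word which neither contains `u` nor is contained in `u` is determined by its
two overlaps with `u`. -/
theorem synEq_of_isMaxOverlap (hv : ¬ u <:+: v) (hv' : ¬ u <:+: v') (hvu : ¬ v <:+: u)
    (hvu' : ¬ v' <:+: u) (hs : IsMaxOverlap u v s) (hs' : IsMaxOverlap u v' s)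
    (hp : IsMaxOverlap v u p) (hp' : IsMaxOverlap v' u p) : SynEq u v v' := by
  intro x y
  rw [infix_append_append_iff hvu, infix_append_append_iff hvu']
  exact or_congr
    ⟨infix_append_left_of_isMaxOverlap hv hs hs' x, infix_append_left_of_isMaxOverlap hv' hs' hs x⟩
    ⟨infix_append_right_of_isMaxOverlap hv hp hp' y,
      infix_append_right_of_isMaxOverlap hv' hp' hp y⟩

/-- Complete the overlap `l` of `v'` to `u = t ++ l`. Then `t ++ v` also contains `u`, and such an
occurrence uses at most `s` letters of `v`, so `|u| ≤ |t| + s`. -/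
theorem SynEq.overlap_left_le {s' : ℕ} (h : SynEq u v v') (hv : ¬ u <:+: v)
    (hs : IsMaxOverlap u v s) (hs' : IsMaxOverlap u v' s') : s' ≤ s := by
  obtain ⟨⟨l, rfl, ⟨t, ht⟩, hl⟩, -⟩ := hs'
  by_contra! hlt
  have hu : u <:+: t ++ v' :=
    List.infix_append_iff.2 (Or.inr (Or.inr ⟨t, l, ht.symm, List.suffix_rfl, hl⟩))
  rcases List.infix_append_iff.1 ((h.append_left_iff t).2 hu) with hx | hx | ⟨l₁, l₂, e, h₁, h₂⟩
  · have := hx.length_le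
    have := congrArg List.length ht
    simp only [List.length_append] at this
    omega
  · exact hv hx
  · have h₃ : l₂.length ≤ s := hs.2 ⟨l₂, rfl, e ▸ List.suffix_append _ _, h₂⟩
    have h₄ := h₁.length_le
    have h₅ := congrArg List.length (ht.trans e)
    simp only [List.length_append] at h₅
    omega

theorem SynEq.overlap_right_le {s' : ℕ} (h : SynEq u v v') (hv : ¬ u <:+: v)
    (hs : IsMaxOverlap v u s) (hs' : IsMaxOverlap v' u s') : s' ≤ s := by
  obtain ⟨⟨l, rfl, hl, ⟨t, ht⟩⟩, -⟩ := hs'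
  by_contra! hlt
  have hu : u <:+: v' ++ t :=
    List.infix_append_iff.2 (Or.inr (Or.inr ⟨l, t, ht.symm, hl, List.prefix_rfl⟩))
  rcases List.infix_append_iff.1 ((h.append_right_iff t).2 hu) with hx | hx | ⟨l₁, l₂, e, h₁, h₂⟩
  · exact hv hx
  · have := hx.length_le
    have := congrArg List.length ht
    simp only [List.length_append] at this
    omega
  · have h₃ : l₁.length ≤ s := hs.2 ⟨l₁, rfl, h₁, e ▸ List.prefix_append _ _⟩
    have h₄ := h₂.length_le
    have h₅ := congrArg List.length (ht.trans e)
    simp only [List.length_append] at h₅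
    omega

/-- Writing `u = xvy`, the word `xv'y` contains `u`, so `|v| ≤ |v'|`. By symmetry the lengths agree,
`xv'y = u`, and cancellation applies. -/
theorem SynEq.eq_of_infix (h : SynEq u v v') (hv : v <:+: u) (hv' : v' <:+: u) : v = v' := by
  obtain ⟨x, y, e⟩ := hv
  obtain ⟨x', y', e'⟩ := hv'
  have h₁ : u <:+: x ++ v' ++ y := (h x y).1 (e ▸ List.infix_rfl)
  have h₂ : u <:+: x' ++ v ++ y' := (h x' y').2 (e' ▸ List.infix_rfl)
  have l₁ := h₁.length_le
  have l₂ := h₂.length_le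
  have k₁ := congrArg List.length e
  have k₂ := congrArg List.length e'
  simp only [List.length_append] at l₁ l₂ k₁ k₂
  have := e.trans (h₁.eq_of_length (by simp only [List.length_append]; omega))
  simpa using this

/-- Otherwise `u` would occur in `xv'` or `v'y`, hence by equivalence in `xv` or `vy`, both of which
are shorter than `u`. -/
theorem SynEq.infix_of_interior (h : SynEq u v v') (hu : x ++ v ++ y = u) (hx : x ≠ [])
    (hy : y ≠ []) : v' <:+: u := by
  by_contra hv'
  have hx := List.length_pos_iff.2 hx
  have hy := List.length_pos_iff.2 hy
  have k := congrArg List.length hu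
  simp only [List.length_append] at k
  rcases infix_append_or_of_infix hv' ((h x y).1 (hu ▸ List.infix_rfl)) with h' | h'
  · have := ((h.append_left_iff x).2 h').length_le
    simp only [List.length_append] at this
    omega
  · have := ((h.append_right_iff y).2 h').length_le
    simp only [List.length_append] at this
    omega

theorem exists_take_drop_eq_of_infix (hv : v ≠ []) (h : v <:+: u) :
    ∃ q : Σ i : Fin u.length, Fin (i + 1), (u.take (q.1 + 1)).drop q.2 = v := by
  obtain ⟨x, y, rfl⟩ := h
  have := List.length_pos_iff.2 hv
  -- A factor is coded by the positions of its last and first letters.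
  refine ⟨⟨⟨x.length + v.length - 1, ?_⟩, ⟨x.length, ?_⟩⟩, ?_⟩
  · simp only [List.length_append]; omega
  · simp only; omega
  · have : x.length + v.length - 1 + 1 = (x ++ v).length := by simp; omega
    simp only
    rw [this, List.take_left, List.drop_left]

theorem card_sigma_fin_succ (n : ℕ) :
    Fintype.card (Σ i : Fin n, Fin (i + 1)) = n * (n + 1) / 2 := by
  have h := Finset.sum_range_succ' (fun i => i) n
  rw [Finset.sum_range_id, Nat.add_sub_cancel, mul_comm, add_zero] at h
  simp only [Fintype.card_sigma, Fintype.card_fin]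
  rw [Fin.sum_univ_eq_sum_range (fun i => i + 1), h]

/-- Finiteness of the syntactic semigroup of `Σ*uΣ*`, and the upper bound on its size: besides the
class of the words containing `u`, there are the factors of `u` and the pairs of overlaps. -/
theorem finite_and_syntacticComplexity_le_length (u : List α) :
    Finite (SyntacticSemigroup (principalIdealLanguage u)) ∧
      syntacticComplexity (principalIdealLanguage u) ≤
        u.length ^ 2 + u.length * (u.length + 1) / 2 + 1 := by
  choose ov hov using exists_isMaxOverlap (α := α)
  let P := (Fin u.length × Fin u.length) ⊕ (Σ i : Fin u.length, Fin (i + 1))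
  have key : ∃ g : List α → Option P,
      ∀ v v' : List α, v ≠ [] → v' ≠ [] → g v = g v' → SynEq u v v' := by
    have hex : ∀ v : List α, ∃ o : Option P, v ≠ [] →
        (o = none ∧ u <:+: v) ∨
        (∃ q, o = some (Sum.inr q) ∧ (u.take (q.1 + 1)).drop q.2 = v) ∨
        (∃ q, o = some (Sum.inl q) ∧ ¬ u <:+: v ∧ ¬ v <:+: u ∧
          ov u v = q.1 ∧ ov v u = q.2) := by
      intro v
      by_cases hv : v ≠ []
      · by_cases h₁ : u <:+: v
        · exact ⟨none, fun _ => Or.inl ⟨rfl, h₁⟩⟩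
        by_cases h₂ : v <:+: u
        · obtain ⟨q, hq⟩ := exists_take_drop_eq_of_infix hv h₂
          exact ⟨some (Sum.inr q), fun _ => Or.inr (Or.inl ⟨q, rfl, hq⟩)⟩
        · exact ⟨some (Sum.inl (⟨ov u v, (hov u v).lt_left h₁⟩, ⟨ov v u, (hov v u).lt_right h₁⟩)),
            fun _ => Or.inr (Or.inr ⟨_, rfl, h₁, h₂, rfl, rfl⟩)⟩
      -- The value on the empty word is arbitrary: only nonempty words are compared.
      · exact ⟨none, fun h => absurd h hv⟩
    choose g hg using hex
    refine ⟨g, fun v v' hv hv' e => ?_⟩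
    rcases hg v hv with ⟨e₁, h₁⟩ | ⟨q, e₁, h₁⟩ | ⟨q, e₁, h₁, h₂, h₃, h₄⟩ <;>
    rcases hg v' hv' with ⟨e₁', h₁'⟩ | ⟨q', e₁', h₁'⟩ | ⟨q', e₁', h₁', h₂', h₃', h₄'⟩ <;>
    rw [e₁, e₁'] at e <;> first | (exfalso; simp at e; done) | skip
    · exact synEq_of_infix h₁ h₁'
    · obtain rfl : q = q' := by simpa using e
      rw [← h₁, ← h₁']
      exact fun _ _ => Iff.rfl
    · obtain rfl : q = q' := by simpa using e
      exact synEq_of_isMaxOverlap h₁ h₁' h₂ h₂' (hov u v) (h₃.trans h₃'.symm ▸ hov u v')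
        (hov v u) (h₄.trans h₄'.symm ▸ hov v' u)
  obtain ⟨g, hg⟩ := key
  obtain ⟨hfin, hle⟩ := finite_and_syntacticComplexity_le g hg
  refine ⟨hfin, hle.trans_eq ?_⟩
  simp only [P, Fintype.card_option, Fintype.card_sum, Fintype.card_prod, Fintype.card_fin,
    card_sigma_fin_succ, sq]

/-- `Nat.card` vanishes on infinite types, so lower bounds need finiteness. -/
instance finite_syntacticSemigroup_principalIdealLanguage (u : List α) :
    Finite (SyntacticSemigroup (principalIdealLanguage u)) :=
  (finite_and_syntacticComplexity_le_length u).1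

end SyntacticEquivalence

/-! ### Realizing pairs of overlaps: the quadratic lower bound -/

section LowerBound

variable {α : Type*} {u v v' S P : List α} {a b c d e h : α} {k s p : ℕ}

theorem singleton_suffix_of_suffix {l : List α} (hu : [e] <:+ u) (hl : l <:+ u) (hne : l ≠ []) :
    [e] <:+ l :=
  List.suffix_of_suffix_length_le hu hl (List.length_pos_iff.2 hne)

theorem singleton_prefix_of_prefix {l : List α} (hu : [h] <+: u) (hl : l <+: u) (hne : l ≠ []) :
    [h] <+: l :=
  List.prefix_of_prefix_length_le hu hl (List.length_pos_iff.2 hne)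

theorem eq_of_mem_of_infix_replicate {l : List α} (hl : l <:+: List.replicate k c) (he : e ∈ l) :
    e = c :=
  List.eq_of_mem_replicate (hl.subset he)

theorem not_infix_append_replicate (hu : [e] <:+ u) (hec : e ≠ c) (hS : S.length < u.length) :
    ¬ u <:+: S ++ List.replicate k c := by
  intro hx
  rcases List.infix_append_iff.1 hx with hx | hx | ⟨l₁, l₂, rfl, h₁, h₂⟩
  · exact absurd hx.length_le (by omega)
  · exact hec (eq_of_mem_of_infix_replicate hx (hu.subset (by simp)))
  · rcases eq_or_ne l₂ [] with rfl | hne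
    · have := h₁.length_le
      simp only [List.append_nil] at hS
      omega
    · have := singleton_suffix_of_suffix hu (List.suffix_append _ _) hne
      exact hec (eq_of_mem_of_infix_replicate h₂.isInfix (this.subset (by simp)))

theorem not_infix_replicate_append (hu : [h] <+: u) (hhd : h ≠ d) (hP : P.length < u.length) :
    ¬ u <:+: List.replicate k d ++ P := by
  intro hx
  rcases List.infix_append_iff.1 hx with hx | hx | ⟨l₁, l₂, rfl, h₁, h₂⟩
  · exact hhd (eq_of_mem_of_infix_replicate hx (hu.subset (by simp)))
  · exact absurd hx.length_le (by omega)
  · rcases eq_or_ne l₁ [] with rfl | hne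
    · have := h₂.length_le
      simp only [List.nil_append] at hP
      omega
    · have := singleton_prefix_of_prefix hu (List.prefix_append _ _) hne
      exact hhd (eq_of_mem_of_infix_replicate h₁.isInfix (this.subset (by simp)))

/-- The runs have length `|u|`, so an occurrence across the middle stays inside them. -/
theorem not_infix_padded (hu : [e] <:+ u) (hec : e ≠ c) (hu' : [h] <+: u) (hhd : h ≠ d)
    (hcd : ¬ u <:+: List.replicate u.length c ++ List.replicate u.length d)
    (hS : S.length < u.length) (hP : P.length < u.length) :
    ¬ u <:+: (S ++ List.replicate u.length c) ++ (List.replicate u.length d ++ P) := by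
  intro hx
  rcases List.infix_append_iff.1 hx with hx | hx | ⟨l₁, l₂, e', h₁, h₂⟩
  · exact not_infix_append_replicate hu hec hS hx
  · exact not_infix_replicate_append hu' hhd hP hx
  · have hl := congrArg List.length e'
    simp only [List.length_append] at hl
    have k₁ : l₁ <:+ List.replicate u.length c :=
      List.suffix_of_suffix_length_le h₁ (List.suffix_append _ _) (by simp; omega)
    have k₂ : l₂ <+: List.replicate u.length d :=
      List.prefix_of_prefix_length_le h₂ (List.prefix_append _ _) (by simp; omega)
    exact hcd (List.infix_append_iff.2 (Or.inr (Or.inr ⟨l₁, l₂, e', k₁, k₂⟩)))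

/-- A criterion for a word with prefix `S` to have left overlap exactly `S` with `u`. -/
theorem isMaxOverlap_append_left (hS : S <:+ u)
    (hm : ∀ m, m ≠ [] → m <+: v → ¬ S ++ m <:+ u) : IsMaxOverlap u (S ++ v) S.length := by
  refine ⟨⟨S, rfl, hS, List.prefix_append _ _⟩, ?_⟩
  rintro _ ⟨l, rfl, hl, hlv⟩
  by_contra! hlt
  obtain ⟨m, rfl⟩ := List.prefix_of_prefix_length_le (List.prefix_append S v) hlv hlt.le
  refine hm m ?_ ((List.prefix_append_right_inj S).1 hlv) hl
  rintro rfl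
  simp at hlt

theorem isMaxOverlap_append_right (hP : P <+: u)
    (hm : ∀ m, m ≠ [] → m <:+ v → ¬ m ++ P <+: u) : IsMaxOverlap (v ++ P) u P.length := by
  refine ⟨⟨P, rfl, List.suffix_append _ _, hP⟩, ?_⟩
  rintro _ ⟨l, rfl, hlv, hl⟩
  by_contra! hlt
  obtain ⟨m, rfl⟩ := List.suffix_of_suffix_length_le (List.suffix_append v P) hlv hlt.le
  refine hm m ?_ (List.suffix_append_self_iff.1 hlv) hl
  rintro rfl
  simp at hlt

theorem isMaxOverlap_padded_left (hu : [e] <:+ u) (hec : e ≠ c) (hS : S <:+ u) :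
    IsMaxOverlap u (S ++ (List.replicate u.length c ++ v)) S.length := by
  refine isMaxOverlap_append_left hS fun m hne hm hSm => ?_
  have hlen := hSm.length_le
  simp only [List.length_append] at hlen
  have k : m <+: List.replicate u.length c :=
    List.prefix_of_prefix_length_le hm (List.prefix_append _ _) (by simp; omega)
  have := singleton_suffix_of_suffix hu ((List.suffix_append S m).trans hSm) hne
  exact hec (eq_of_mem_of_infix_replicate k.isInfix (this.subset (by simp)))

theorem isMaxOverlap_padded_right (hu : [h] <+: u) (hhd : h ≠ d) (hP : P <+: u) :
    IsMaxOverlap ((v ++ List.replicate u.length d) ++ P) u P.length := by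
  refine isMaxOverlap_append_right hP fun m hne hm hSm => ?_
  have hlen := hSm.length_le
  simp only [List.length_append] at hlen
  have k : m <:+ List.replicate u.length d :=
    List.suffix_of_suffix_length_le hm (List.suffix_append _ _) (by simp; omega)
  have := singleton_prefix_of_prefix hu ((List.prefix_append m P).trans hSm) hne
  exact hhd (eq_of_mem_of_infix_replicate k.isInfix (this.subset (by simp)))

/-- If `u` does not end in `c`, does not begin with `d` and is no factor of `c ⋯ c d ⋯ d`, then all
pairs of overlaps are realized by words which are not factors of `u`. -/
theorem exists_isMaxOverlap_of_padding (hu : [e] <:+ u) (hec : e ≠ c) (hu' : [h] <+: u)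
    (hhd : h ≠ d) (hcd : ¬ u <:+: List.replicate u.length c ++ List.replicate u.length d)
    (hs : s < u.length) (hp : p < u.length) :
    ∃ v : List α, v ≠ [] ∧ ¬ u <:+: v ∧ ¬ v <:+: u ∧ IsMaxOverlap u v s ∧ IsMaxOverlap v u p := by
  have hlS : (u.drop (u.length - s)).length = s := by simp; omega
  have hlP : (u.take p).length = p := by simp; omega
  refine ⟨(u.drop (u.length - s) ++ List.replicate u.length c) ++
    (List.replicate u.length d ++ u.take p), ?_, ?_, ?_, ?_, ?_⟩
  · rw [← List.length_pos_iff]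
    simp only [List.length_append, List.length_replicate]
    omega
  · exact not_infix_padded hu hec hu' hhd hcd (by omega) (by omega)
  · intro hx
    have := hx.length_le
    simp only [List.length_append, List.length_replicate] at this
    omega
  · have := isMaxOverlap_padded_left (v := List.replicate u.length d ++ u.take p) hu hec
      (List.drop_suffix (u.length - s) u)
    rwa [hlS, ← List.append_assoc] at this
  · have := isMaxOverlap_padded_right (v := u.drop (u.length - s) ++ List.replicate u.length c)
      hu' hhd (List.take_prefix p u)
    rwa [hlP, List.append_assoc] at this

theorem eq_and_eq_of_pair_infix {i j : ℕ} {x y : α} (hxy : x ≠ y)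
    (hx : [x, y] <:+: List.replicate i c ++ List.replicate j d) : x = c ∧ y = d := by
  rcases List.infix_append_iff.1 hx with hx | hx | ⟨l₁, l₂, e', h₁, h₂⟩
  · exact absurd ((eq_of_mem_of_infix_replicate hx (by simp)).trans
      (eq_of_mem_of_infix_replicate hx (by simp)).symm) hxy
  · exact absurd ((eq_of_mem_of_infix_replicate hx (by simp)).trans
      (eq_of_mem_of_infix_replicate hx (by simp)).symm) hxy
  · rcases l₁ with _ | ⟨x', _ | ⟨y', l₁⟩⟩
    · rw [List.nil_append] at e'
      subst e'
      exact absurd ((eq_of_mem_of_infix_replicate h₂.isInfix (by simp)).trans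
        (eq_of_mem_of_infix_replicate h₂.isInfix (by simp)).symm) hxy
    · simp only [List.cons_append, List.nil_append, List.cons.injEq] at e'
      obtain ⟨rfl, rfl⟩ := e'
      exact ⟨eq_of_mem_of_infix_replicate h₁.isInfix (by simp),
        eq_of_mem_of_infix_replicate h₂.isInfix (by simp)⟩
    · simp only [List.cons_append, List.cons.injEq] at e'
      obtain ⟨rfl, rfl, -⟩ := e'
      exact absurd ((eq_of_mem_of_infix_replicate h₁.isInfix (by simp)).trans
        (eq_of_mem_of_infix_replicate h₁.isInfix (by simp)).symm) hxy

theorem eq_replicate_append_replicate {i j : ℕ} (hu : [e] <:+ u) (hu' : [h] <+: u) (hhe : h ≠ e)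
    (hx : u <:+: List.replicate i h ++ List.replicate j e) :
    ∃ i j, u = List.replicate i h ++ List.replicate j e := by
  rcases List.infix_append_iff.1 hx with hx | hx | ⟨l₁, l₂, rfl, h₁, h₂⟩
  · exact absurd (eq_of_mem_of_infix_replicate hx (hu.subset (by simp))) hhe.symm
  · exact absurd (eq_of_mem_of_infix_replicate hx (hu'.subset (by simp))) hhe
  · exact ⟨_, _, by rw [← (List.suffix_replicate_iff.1 h₁).2, ← (List.prefix_replicate_iff.1 h₂).2]⟩

theorem pair_infix_append {x y : List α} (hx : [e] <:+ x) (hy : [h] <+: y) :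
    [e, h] <:+: x ++ y :=
  List.infix_append_iff.2 (Or.inr (Or.inr ⟨[e], [h], rfl, hx, hy⟩))

/-- A word `h ⋯ h e ⋯ e` has no proper nonempty border. -/
theorem eq_self_of_border {i j : ℕ} {l : List α} (hhe : h ≠ e)
    (hu : [e] <:+ u) (hu' : [h] <+: u) (he : u = List.replicate i h ++ List.replicate j e)
    (hne : l ≠ []) (hp : l <+: u) (hs : l <:+ u) : l = u := by
  classical
  have hl := singleton_suffix_of_suffix hu hs hne
  have hl' := singleton_prefix_of_prefix hu' hp hne
  -- In `u` no `e` precedes an `h`, while a nonempty border contains both letters.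
  have heh : ∀ x y : List α, x ++ y = u → e ∈ x → h ∉ y := by
    intro x y hxy hex hhy
    have k₁ : List.Pairwise (fun z w => z = h ∨ w = e) u := by
      rw [he, List.pairwise_append]
      refine ⟨List.pairwise_of_forall_mem_list ?_, List.pairwise_of_forall_mem_list ?_, ?_⟩
      · exact fun z hz w _ => Or.inl (List.eq_of_mem_replicate hz)
      · exact fun z _ w hw => Or.inr (List.eq_of_mem_replicate hw)
      · exact fun z hz w _ => Or.inl (List.eq_of_mem_replicate hz)
    rw [← hxy, List.pairwise_append] at k₁
    rcases k₁.2.2 e hex h hhy with k | k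
    exacts [hhe k.symm, hhe k]
  obtain ⟨r, hr⟩ := hp
  obtain ⟨r', hr'⟩ := hs
  have h₁ : h ∉ r := heh l r hr (hl.subset (by simp))
  have h₂ : e ∉ r' := fun hx => heh r' l hr' hx (hl'.subset (by simp))
  have hcnt := congrArg (List.count e) (hr.trans hr'.symm)
  rw [List.count_append, List.count_append, List.count_eq_zero_of_not_mem h₂] at hcnt
  have h₃ : e ∉ r := List.count_eq_zero.1 (by omega)
  have h₄ : r = [] := by
    rw [List.eq_nil_iff_forall_not_mem]
    intro z hz
    have : z ∈ u := hr ▸ List.mem_append_right _ hz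
    rw [he, List.mem_append] at this
    rcases this with hz' | hz' <;> obtain rfl := List.eq_of_mem_replicate hz'
    exacts [h₁ hz, h₃ hz]
  rw [← hr, h₄, List.append_nil]

/-- For `u = h ⋯ h e ⋯ e` all pairs of overlaps other than `(0, 0)` are realized. -/
theorem exists_isMaxOverlap_of_two_blocks {i j : ℕ} (hhe : h ≠ e)
    (hu : [e] <:+ u) (hu' : [h] <+: u) (he : u = List.replicate i h ++ List.replicate j e)
    (hs : s < u.length) (hp : p < u.length) (hsp : s ≠ 0 ∨ p ≠ 0) :
    ∃ v : List α, v ≠ [] ∧ ¬ u <:+: v ∧ IsMaxOverlap u v s ∧ IsMaxOverlap v u p := by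
  have hlS : (u.drop (u.length - s)).length = s := by simp; omega
  have hlP : (u.take p).length = p := by simp; omega
  have hS := List.drop_suffix (u.length - s) u
  have hP := List.take_prefix p u
  generalize u.drop (u.length - s) = S at *
  generalize u.take p = P at *
  subst hlS hlP
  have hnot : ¬ [e, h] <:+: u := fun hx => hhe (eq_and_eq_of_pair_infix hhe.symm (he ▸ hx)).2
  refine ⟨S ++ P, ?_, ?_, ?_, ?_⟩
  · rw [← List.length_pos_iff, List.length_append]
    omega
  · intro hx
    rcases List.infix_append_iff.1 hx with hx | hx | ⟨l₁, l₂, e', h₁, h₂⟩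
    · exact absurd hx.length_le (by omega)
    · exact absurd hx.length_le (by omega)
    · have hl := congrArg List.length e'
      have k₁ := h₁.length_le
      have k₂ := h₂.length_le
      simp only [List.length_append] at hl
      -- Crossing the junction of `S` and `P` would put the factor `eh` into `u`.
      refine hnot (e' ▸ pair_infix_append
        (singleton_suffix_of_suffix (singleton_suffix_of_suffix hu hS ?_) h₁ ?_)
        (singleton_prefix_of_prefix (singleton_prefix_of_prefix hu' hP ?_) h₂ ?_)) <;>
      · rw [← List.length_pos_iff]
        omega
  · refine isMaxOverlap_append_left hS fun m hne hm hSm => ?_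
    have hm' := singleton_prefix_of_prefix hu' (hm.trans hP) hne
    rcases eq_or_ne S [] with rfl | hSne
    -- With `S` empty, `m` is a border of `u`, hence all of `u`, but it is also a prefix of the
    -- shorter word `P`.
    · have := eq_self_of_border hhe hu hu' he hne (hm.trans hP) hSm
      have := hm.length_le
      simp_all
      omega
    · exact hnot ((pair_infix_append (singleton_suffix_of_suffix hu hS hSne) hm').trans
        hSm.isInfix)
  · refine isMaxOverlap_append_right hP fun m hne hm hSm => ?_
    have hm' := singleton_suffix_of_suffix hu (hm.trans hS) hne
    rcases eq_or_ne P [] with rfl | hPne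
    · rw [List.append_nil] at hSm
      have := eq_self_of_border hhe hu hu' he hne hSm (hm.trans hS)
      have := hm.length_le
      simp_all
      omega
    · exact hnot ((pair_infix_append hm' (singleton_prefix_of_prefix hu' hP hPne)).trans
        hSm.isInfix)

theorem SynEq.overlaps_eq {s' p' : ℕ} (hvv : SynEq u v v') (hv : ¬ u <:+: v)
    (hs : IsMaxOverlap u v s) (hs' : IsMaxOverlap u v' s') (hp : IsMaxOverlap v u p)
    (hp' : IsMaxOverlap v' u p') : s = s' ∧ p = p' := by
  have hv' : ¬ u <:+: v' := fun hx => hv (hvv.infix_iff.2 hx)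
  exact ⟨le_antisymm (hvv.symm.overlap_left_le hv' hs' hs) (hvv.overlap_left_le hv hs hs'),
    le_antisymm (hvv.symm.overlap_right_le hv' hp' hp) (hvv.overlap_right_le hv hp hp')⟩

theorem exists_singleton_suffix (hu : u ≠ []) : ∃ e, [e] <:+ u :=
  ⟨u.getLast hu, u.dropLast, List.dropLast_append_getLast hu⟩

theorem exists_singleton_prefix (hu : u ≠ []) : ∃ h, [h] <+: u :=
  ⟨u.head hu, u.tail, List.cons_head_tail hu⟩

theorem sq_le_syntacticComplexity_of_padding (hu : [e] <:+ u) (hec : e ≠ c) (hu' : [h] <+: u)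
    (hhd : h ≠ d) (hcd : ¬ u <:+: List.replicate u.length c ++ List.replicate u.length d) :
    u.length ^ 2 ≤ syntacticComplexity (principalIdealLanguage u) := by
  choose f hne hv hvu hs hp using fun q : Fin u.length × Fin u.length =>
    exists_isMaxOverlap_of_padding hu hec hu' hhd hcd q.1.2 q.2.2
  have := card_le_syntacticComplexity (u := u) f hne fun q q' hq => by
    obtain ⟨h₁, h₂⟩ := hq.overlaps_eq (hv q) (hs q) (hs q') (hp q) (hp q')
    exact Prod.ext (Fin.ext h₁) (Fin.ext h₂)
  simpa [sq] using this

theorem sq_le_syntacticComplexity_of_two_blocks {i j : ℕ} (hhe : h ≠ e)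
    (hu : [e] <:+ u) (hu' : [h] <+: u) (he : u = List.replicate i h ++ List.replicate j e) :
    u.length ^ 2 ≤ syntacticComplexity (principalIdealLanguage u) := by
  have hex : ∀ q : Fin u.length × Fin u.length, ∃ v : List α, v ≠ [] ∧
      (((q.1 : ℕ) = 0 ∧ (q.2 : ℕ) = 0 ∧ u <:+: v) ∨
        (¬ u <:+: v ∧ IsMaxOverlap u v q.1 ∧ IsMaxOverlap v u q.2)) := by
    intro q
    by_cases hq : (q.1 : ℕ) ≠ 0 ∨ (q.2 : ℕ) ≠ 0
    · obtain ⟨v, h₁, h₂⟩ := exists_isMaxOverlap_of_two_blocks hhe hu hu' he q.1.2 q.2.2 hq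
      exact ⟨v, h₁, Or.inr h₂⟩
    · push Not at hq
      exact ⟨u, List.length_pos_iff.1 (Nat.zero_lt_of_lt q.1.2), Or.inl ⟨hq.1, hq.2, List.infix_rfl⟩⟩
  choose f hne hf using hex
  have := card_le_syntacticComplexity (u := u) f hne fun q q' hq => by
    rcases hf q with ⟨h₁, h₂, h₃⟩ | ⟨h₃, h₁, h₂⟩ <;>
    rcases hf q' with ⟨h₁', h₂', h₃'⟩ | ⟨h₃', h₁', h₂'⟩
    · exact Prod.ext (Fin.ext (h₁.trans h₁'.symm)) (Fin.ext (h₂.trans h₂'.symm))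
    · exact absurd (hq.infix_iff.1 h₃) h₃'
    · exact absurd (hq.infix_iff.2 h₃') h₃
    · obtain ⟨k₁, k₂⟩ := hq.overlaps_eq h₃ h₁ h₁' h₂ h₂'
      exact Prod.ext (Fin.ext k₁) (Fin.ext k₂)
  simpa [sq] using this

theorem sq_le_syntacticComplexity [Nontrivial α] (u : List α) :
    u.length ^ 2 ≤ syntacticComplexity (principalIdealLanguage u) := by
  rcases eq_or_ne u [] with rfl | hne
  · simp
  obtain ⟨e, he⟩ := exists_singleton_suffix hne
  obtain ⟨h, hh⟩ := exists_singleton_prefix hne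
  by_cases hhe : h = e
  · obtain ⟨c, hc⟩ := exists_ne e
    -- With equal end letters, one letter `c` different from them pads both sides.
    refine sq_le_syntacticComplexity_of_padding he hc.symm hh (hhe ▸ hc.symm) fun hx => ?_
    rw [← List.replicate_add] at hx
    exact hc (eq_of_mem_of_infix_replicate hx (he.subset (by simp))).symm
  by_cases hx : u <:+: List.replicate u.length h ++ List.replicate u.length e
  · obtain ⟨i, j, hij⟩ := eq_replicate_append_replicate he hh hhe hx
    exact sq_le_syntacticComplexity_of_two_blocks hhe he hh hij
  · exact sq_le_syntacticComplexity_of_padding he (Ne.symm hhe) hh hhe hx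

/-- The padded lower bound together with a family of pairwise distinct interior factors. -/
theorem sq_add_card_le_syntacticComplexity (hu : [e] <:+ u) (hec : e ≠ c) (hu' : [h] <+: u)
    (hhd : h ≠ d) (hcd : ¬ u <:+: List.replicate u.length c ++ List.replicate u.length d)
    {ι : Type*} [Fintype ι] (g : ι → List α) (hg : Function.Injective g) (hne : ∀ i, g i ≠ [])
    (hint : ∀ i, ∃ x y, x ≠ [] ∧ y ≠ [] ∧ x ++ g i ++ y = u) :
    u.length ^ 2 + Fintype.card ι ≤ syntacticComplexity (principalIdealLanguage u) := by
  choose f hf hv hvu hs hp using fun q : Fin u.length × Fin u.length =>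
    exists_isMaxOverlap_of_padding hu hec hu' hhd hcd q.1.2 q.2.2
  have hgu : ∀ i, g i <:+: u := fun i => by
    obtain ⟨x, y, -, -, e⟩ := hint i
    exact ⟨x, y, e⟩
  have hdis : ∀ q i, ¬ SynEq u (g i) (f q) := fun q i hq => by
    obtain ⟨x, y, hx, hy, e⟩ := hint i
    exact hvu q (hq.infix_of_interior e hx hy)
  have := card_le_syntacticComplexity (u := u) (Sum.elim f g) (by rintro (q | i); exacts [hf q, hne i])
    (by
      rintro (q | i) (q' | i') hq
      · obtain ⟨h₁, h₂⟩ := hq.overlaps_eq (hv q) (hs q) (hs q') (hp q) (hp q')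
        exact congrArg _ (Prod.ext (Fin.ext h₁) (Fin.ext h₂))
      · exact absurd hq.symm (hdis q i')
      · exact absurd hq (hdis q' i)
      · exact congrArg _ (hg (hq.eq_of_infix (hgu i) (hgu i'))))
  simpa [sq] using this

end LowerBound

/-! ### The infinite word `ab²a³b⁴⋯` and its long factors -/

section BlockWord

variable {α : Type*} (a b : α)

/-- The `k`-th triangular number. -/
def triangular (k : ℕ) : ℕ := k * (k + 1) / 2

theorem two_mul_triangular (k : ℕ) : 2 * triangular k = k * (k + 1) :=
  Nat.mul_div_cancel' (Nat.even_mul_succ_self k).two_dvd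

theorem triangular_succ (k : ℕ) : triangular (k + 1) = triangular k + (k + 1) := by
  have h₁ := two_mul_triangular k
  have h₂ := two_mul_triangular (k + 1)
  nlinarith

theorem triangular_strictMono : StrictMono triangular :=
  strictMono_nat_of_lt_succ fun k => by rw [triangular_succ]; omega

/-- The index of the block of `a b² a³ b⁴ ⋯` containing position `i`. -/
def blockIndex (i : ℕ) : ℕ := Nat.findGreatest (fun m => triangular m ≤ i) i

theorem triangular_blockIndex_le (i : ℕ) : triangular (blockIndex i) ≤ i :=
  Nat.findGreatest_spec (P := fun m => triangular m ≤ i) (Nat.zero_le i) (Nat.zero_le i)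

theorem lt_triangular_blockIndex_succ (i : ℕ) : i < triangular (blockIndex i + 1) := by
  by_contra! h
  -- The search bound `i` loses nothing, because `m ≤ triangular m`.
  have h₁ : blockIndex i + 1 ≤ i := (triangular_strictMono.le_apply).trans h
  exact absurd (Nat.le_findGreatest (P := fun m => triangular m ≤ i) h₁ h)
    (by unfold blockIndex; omega)

theorem blockIndex_eq {i m : ℕ} (h₁ : triangular m ≤ i) (h₂ : i < triangular (m + 1)) :
    blockIndex i = m := by
  have k₁ := triangular_strictMono.lt_iff_lt.1 (h₁.trans_lt (lt_triangular_blockIndex_succ i))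
  have k₂ := triangular_strictMono.lt_iff_lt.1 ((triangular_blockIndex_le i).trans_lt h₂)
  omega

/-- The letter at position `i` of the infinite word `a b² a³ b⁴ ⋯`. -/
def blockLetter (i : ℕ) : α := if Even (blockIndex i) then a else b

theorem blockLetter_eq {i m : ℕ} (h₁ : triangular m ≤ i) (h₂ : i < triangular (m + 1)) :
    blockLetter a b i = if Even m then a else b := by
  rw [blockLetter, blockIndex_eq h₁ h₂]

variable {a b}

theorem blockLetter_ne_succ_iff (hab : a ≠ b) {i : ℕ} :
    blockLetter a b i ≠ blockLetter a b (i + 1) ↔ ∃ m, i + 1 = triangular (m + 1) := by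
  constructor
  · intro h
    refine ⟨blockIndex i, ?_⟩
    have h₁ := triangular_blockIndex_le i
    have h₂ := lt_triangular_blockIndex_succ i
    by_contra hne
    exact h ((blockLetter_eq a b h₁ h₂).trans
      (blockLetter_eq a b (h₁.trans i.le_succ) (by omega)).symm)
  · rintro ⟨m, hm⟩
    have h₁ := triangular_succ m
    have h₂ := triangular_succ (m + 1)
    rw [blockLetter_eq a b (m := m) (by omega) (by omega),
      blockLetter_eq a b (m := m + 1) (by omega) (by omega)]
    by_cases hm : Even m
    · simpa [hm, Nat.even_add_one] using hab
    · simpa [hm, Nat.even_add_one] using hab.symm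

/-- Long factors of `a b² a³ b⁴ ⋯` determine their position: they contain a complete block. -/
theorem eq_of_blockLetter_eq (hab : a ≠ b) {i j l : ℕ} (hl : 2 * blockIndex i + 3 < l)
    (h : ∀ t < l, blockLetter a b (i + t) = blockLetter a b (j + t)) : i = j := by
  -- Equal factors change letter at the same offsets, and the changes are exactly the block
  -- boundaries.
  have hiff : ∀ t, t + 1 < l → ((∃ m, i + t + 1 = triangular (m + 1)) ↔
      ∃ m, j + t + 1 = triangular (m + 1)) := by
    intro t ht
    rw [← blockLetter_ne_succ_iff hab, ← blockLetter_ne_succ_iff hab, h t (by omega),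
      add_assoc i, add_assoc j, h (t + 1) ht]
  obtain ⟨m, hm⟩ : ∃ m, blockIndex i = m := ⟨_, rfl⟩
  have h₁ := triangular_blockIndex_le i
  have h₂ := lt_triangular_blockIndex_succ i
  rw [hm] at h₁ h₂ hl
  have e₁ := triangular_succ m
  have e₂ := triangular_succ (m + 1)
  obtain ⟨p, hp⟩ : ∃ p, i + p + 1 = triangular (m + 1) :=
    ⟨triangular (m + 1) - i - 1, by omega⟩
  obtain ⟨m₁, hm₁⟩ := (hiff p (by omega)).1 ⟨m, hp⟩
  -- Here `p ≤ m`, so the boundary after the next full block, at offset `p + m + 2`, is visible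
  -- because `2m + 3 < l`.
  obtain ⟨m₂, hm₂⟩ := (hiff (p + (m + 2)) (by omega)).1 ⟨m + 1, by omega⟩
  have e₃ := triangular_succ (m₁ + 1)
  have hlt : m₁ + 1 < m₂ + 1 := triangular_strictMono.lt_iff_lt.1 (by omega)
  have hle : triangular (m₁ + 1 + 1) ≤ triangular (m₂ + 1) :=
    triangular_strictMono.monotone (by omega)
  by_contra hij
  have hmm : m₁ < m := by
    rcases lt_trichotomy m₁ m with h | rfl | h
    · exact h
    · omega
    · omega
  -- If `m₁ < m`, the shorter block on the side of `j` would put a boundary strictly between two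
  -- consecutive boundaries on the side of `i`.
  obtain ⟨r, hr⟩ := (hiff (p + (m₁ + 2)) (by omega)).2 ⟨m₁ + 1, by omega⟩
  have k₁ := triangular_strictMono.lt_iff_lt.1
    (show triangular (m + 1) < triangular (r + 1) by omega)
  have k₂ := triangular_strictMono.lt_iff_lt.1
    (show triangular (r + 1) < triangular (m + 1 + 1) by omega)
  omega

variable (a b) in
/-- The prefix of length `n` of the infinite word `a b² a³ b⁴ ⋯`. -/
def blockWord (n : ℕ) : List α := (List.range n).map (blockLetter a b)

theorem length_blockWord (n : ℕ) : (blockWord a b n).length = n := by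
  simp [blockWord]

theorem blockWord_triangular_add {k l : ℕ} (hl : l ≤ k + 1) :
    blockWord a b (triangular k + l) =
      blockWord a b (triangular k) ++ List.replicate l (if Even k then a else b) := by
  rw [blockWord, List.range_add, List.map_append, blockWord, List.append_cancel_left_eq,
    List.eq_replicate_iff]
  refine ⟨by simp, ?_⟩
  simp only [List.map_map, List.mem_map, List.mem_range, Function.comp]
  rintro _ ⟨t, ht, rfl⟩
  exact blockLetter_eq a b (by omega) (by rw [triangular_succ]; omega)

theorem blockWord_triangular (k : ℕ) : blockWord a b (triangular k) = alternatingBlocks a b k := by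
  induction k with
  | zero => rfl
  | succ k ih => rw [triangular_succ, blockWord_triangular_add le_rfl, ih, alternatingBlocks]

theorem blockWord_eq_append (m : ℕ) :
    ∃ t, blockWord a b (4 + m) = [a, b, b, a] ++ t := by
  refine ⟨((List.range m).map (4 + ·)).map (blockLetter a b), ?_⟩
  rw [blockWord, List.range_add, List.map_append]
  congr 1

theorem blockIndex_le_sqrt {i n : ℕ} (hi : i ≤ n) : blockIndex i ≤ Nat.sqrt (2 * n) := by
  rw [Nat.le_sqrt]
  have := two_mul_triangular (blockIndex i)
  have := triangular_blockIndex_le i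
  nlinarith

variable (a b) in
/-- The factor of `a b² a³ b⁴ ⋯` of length `l` starting at position `i`. -/
def blockFactor (i l : ℕ) : List α := (List.range' i l).map (blockLetter a b)

theorem blockFactor_append (i l m : ℕ) :
    blockFactor a b i l ++ blockFactor a b (i + l) m = blockFactor a b i (l + m) := by
  have := List.range'_append (s := i) (m := l) (n := m) (step := 1)
  rw [one_mul] at this
  rw [blockFactor, blockFactor, ← List.map_append, this, blockFactor]

theorem length_blockFactor (i l : ℕ) : (blockFactor a b i l).length = l := by
  simp [blockFactor]

theorem blockFactor_inj (hab : a ≠ b) {i j l l' : ℕ} (hl : 2 * blockIndex i + 3 < l)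
    (h : blockFactor a b i l = blockFactor a b j l') : i = j ∧ l = l' := by
  have hll : l = l' := by simpa [length_blockFactor] using congrArg List.length h
  subst hll
  refine ⟨eq_of_blockLetter_eq hab hl fun t ht => ?_, rfl⟩
  have := congrArg (fun w => w[t]?) h
  simpa [blockFactor, ht] using this

theorem two_mul_le_syntacticComplexity_blockWord (hab : a ≠ b) {n N : ℕ} (hn : 4 ≤ n)
    (hN : N = n - (2 * Nat.sqrt (2 * n) + 5)) :
    2 * n ^ 2 + N ^ 2 ≤ 2 * syntacticComplexity (principalIdealLanguage (blockWord a b n)) := by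
  set l := 2 * Nat.sqrt (2 * n) + 4 with hl
  have hlen : (blockWord a b n).length = n := length_blockWord n
  obtain ⟨t, ht⟩ := blockWord_eq_append (a := a) (b := b) (n - 4)
  rw [Nat.add_sub_cancel' hn] at ht
  have hhead : [a] <+: blockWord a b n := ⟨[b, b, a] ++ t, by rw [ht]; rfl⟩
  have hba : [b, a] <:+: blockWord a b n := ⟨[a, b], t, by rw [ht]; rfl⟩
  have hne : blockWord a b n ≠ [] := by
    rw [ht]
    simp
  obtain ⟨e, he⟩ := exists_singleton_suffix hne
  obtain ⟨c, hc⟩ : ∃ c, e ≠ c := by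
    by_cases hea : e = a
    exacts [⟨b, hea ▸ hab⟩, ⟨a, hea⟩]
  -- The pair `(t, r)` stands for the factor on positions `1 + r` to `t + l`: its length is at least
  -- `l`, and a letter remains on each side.
  have hlt : ∀ q : (Σ t : Fin N, Fin (t + 1)), (q.2 : ℕ) ≤ q.1 ∧ 1 + (q.1 : ℕ) + l < n := by
    intro q
    have h₁ := q.2.2
    have h₂ := q.1.2
    omega
  have := sq_add_card_le_syntacticComplexity he hc hhead hab
    (fun hx => hab (eq_and_eq_of_pair_infix hab.symm (hba.trans hx)).2)
    (fun q : (Σ t : Fin N, Fin (t + 1)) => blockFactor a b (1 + q.2) (q.1 + l - q.2)) ?_ ?_ ?_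
  · rw [card_sigma_fin_succ, hlen] at this
    have h₂ := two_mul_triangular N
    rw [triangular] at h₂
    nlinarith
  · rintro ⟨t, r⟩ ⟨t', r'⟩ h
    have h₁ := hlt ⟨t, r⟩
    have h₂ := hlt ⟨t', r'⟩
    simp only at h h₁ h₂
    have hs := blockIndex_le_sqrt (show 1 + (r : ℕ) ≤ n by omega)
    obtain ⟨k₁, k₂⟩ := blockFactor_inj hab (by omega) h
    obtain rfl : t = t' := Fin.ext (by omega)
    obtain rfl : r = r' := Fin.ext (by omega)
    rfl
  · intro q
    have h₁ := hlt q
    rw [← List.length_pos_iff, length_blockFactor]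
    omega
  · intro q
    have h₁ := hlt q
    refine ⟨blockFactor a b 0 (1 + q.2), blockFactor a b (1 + q.1 + l) (n - (1 + q.1 + l)),
      ?_, ?_, ?_⟩
    · rw [← List.length_pos_iff, length_blockFactor]
      omega
    · rw [← List.length_pos_iff, length_blockFactor]
      omega
    · have k := blockFactor_append (a := a) (b := b) 0 (1 + q.2) (q.1 + l - q.2)
      rw [zero_add, show 1 + (q.2 : ℕ) + (q.1 + l - q.2) = 1 + q.1 + l by omega] at k
      have k' := blockFactor_append (a := a) (b := b) 0 (1 + q.1 + l) (n - (1 + q.1 + l))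
      rw [zero_add, show 1 + (q.1 : ℕ) + l + (n - (1 + q.1 + l)) = n by omega] at k'
      rw [k, k', blockFactor, blockWord, List.range_eq_range']

theorem syntacticComplexity_le_real (u : List α) :
    (syntacticComplexity (principalIdealLanguage u) : ℝ) ≤
      1.5 * (u.length : ℝ) ^ 2 + (u.length + 1) := by
  have h := (finite_and_syntacticComplexity_le_length u).2
  have h₂ : u.length * (u.length + 1) / 2 * 2 ≤ u.length * (u.length + 1) := Nat.div_mul_le_self _ 2
  have h₃ : 2 * syntacticComplexity (principalIdealLanguage u) ≤
    3 * u.length ^ 2 + u.length + 2 := by nlinarith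
  have h₄ : (2 : ℝ) * syntacticComplexity (principalIdealLanguage u) ≤
    3 * (u.length : ℝ) ^ 2 + u.length + 2 := by exact_mod_cast h₃
  have : (0 : ℝ) ≤ u.length := Nat.cast_nonneg _
  linarith

theorem le_syntacticComplexity_blockWord_real (hab : a ≠ b) {n : ℕ} (hn : 4 ≤ n) :
    1.5 * (n : ℝ) ^ 2 - n * (2 * √(2 * n) + 5) ≤
      syntacticComplexity (principalIdealLanguage (blockWord a b n)) := by
  have h := two_mul_le_syntacticComplexity_blockWord hab hn rfl
  have h' : (2 : ℝ) * n ^ 2 + ((n - (2 * Nat.sqrt (2 * n) + 5) : ℕ) : ℝ) ^ 2 ≤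
    2 * syntacticComplexity (principalIdealLanguage (blockWord a b n)) := by exact_mod_cast h
  have hs : (Nat.sqrt (2 * n) : ℝ) ≤ √(2 * n) := by
    simpa using Real.nat_sqrt_le_real_sqrt (a := 2 * n)
  have hn0 : (0 : ℝ) ≤ n := Nat.cast_nonneg n
  have hs0 : (0 : ℝ) ≤ Nat.sqrt (2 * n) := Nat.cast_nonneg _
  have hmul := mul_le_mul_of_nonneg_left hs hn0
  rcases le_total (2 * Nat.sqrt (2 * n) + 5) n with hle | hle
  · rw [Nat.cast_sub hle] at h'
    push_cast at h'
    nlinarith [sq_nonneg (2 * (Nat.sqrt (2 * n) : ℝ) + 5)]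
  -- The truncated difference is `0` here, and `n²` alone suffices.
  · have hle' : (n : ℝ) ≤ 2 * Nat.sqrt (2 * n) + 5 := by exact_mod_cast hle
    nlinarith [sq_nonneg ((n - (2 * Nat.sqrt (2 * n) + 5) : ℕ) : ℝ)]

end BlockWord

/-! ### Error terms of order `n√n` -/

section Asymptotics

theorem isLittleO_natCast_sq {f : ℕ → ℝ} (hf : f =O[atTop] fun n : ℕ => (n : ℝ) * √n) :
    f =o[atTop] fun n : ℕ => (n : ℝ) ^ 2 := by
  refine hf.trans_isLittleO ?_
  have h : (fun n : ℕ => √(n : ℝ)) =o[atTop] fun n : ℕ => (n : ℝ) := by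
    have := (isLittleO_pow_pow_atTop_of_lt (𝕜 := ℝ) one_lt_two).comp_tendsto
      (Real.tendsto_sqrt_atTop.comp tendsto_natCast_atTop_atTop)
    simpa [Function.comp_def] using this
  simpa [sq] using (isBigO_refl (fun n : ℕ => (n : ℝ)) atTop).mul_isLittleO h

theorem natCast_le_mul_sqrt (n : ℕ) : (n : ℝ) ≤ n * √n := by
  rcases Nat.eq_zero_or_pos n with rfl | hn
  · simp
  · have : (1 : ℝ) ≤ √n := Real.one_le_sqrt.2 (by exact_mod_cast hn)
    nlinarith [Nat.cast_nonneg (α := ℝ) n]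

theorem isLittleO_natCast_succ : (fun n : ℕ => (n : ℝ) + 1) =o[atTop] fun n : ℕ => (n : ℝ) ^ 2 := by
  refine isLittleO_natCast_sq (IsBigO.of_bound 2 ?_)
  filter_upwards [eventually_ge_atTop 1] with n hn
  have h₁ := natCast_le_mul_sqrt n
  have h₂ : (1 : ℝ) ≤ n := by exact_mod_cast hn
  rw [Real.norm_of_nonneg (by positivity), Real.norm_of_nonneg (by positivity)]
  linarith

theorem isLittleO_syntacticComplexity_blockWord {α : Type*} {a b : α} (hab : a ≠ b) :
    (fun n : ℕ => (syntacticComplexity (principalIdealLanguage (blockWord a b n)) : ℝ)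
      - 1.5 * (n : ℝ) ^ 2) =o[atTop] fun n : ℕ => (n : ℝ) ^ 2 := by
  -- `9 = 4 + 5`, from `n(2√(2n) + 5) ≤ 4n√n + 5n`.
  refine isLittleO_natCast_sq (IsBigO.of_bound 9 ?_)
  filter_upwards [eventually_ge_atTop 4] with n hn
  have h₁ := natCast_le_mul_sqrt n
  have h₂ : (4 : ℝ) ≤ n := by exact_mod_cast hn
  have h₃ := syntacticComplexity_le_real (blockWord a b n)
  rw [length_blockWord] at h₃
  have h₄ := le_syntacticComplexity_blockWord_real hab hn
  have h₅ : √(2 * (n : ℝ)) ≤ 2 * √n := by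
    rw [Real.sqrt_mul zero_le_two]
    have : √(2 : ℝ) ≤ 2 := Real.sqrt_le_iff.2 ⟨by norm_num, by norm_num⟩
    exact mul_le_mul_of_nonneg_right this (Real.sqrt_nonneg _)
  have h₆ := mul_le_mul_of_nonneg_left h₅ (by linarith : (0 : ℝ) ≤ n)
  rw [Real.norm_eq_abs, Real.norm_of_nonneg (by positivity), abs_le]
  constructor <;> nlinarith

end Asymptotics

theorem mainTheorem5 {α : Type*} [Finite α] (a b : α) (hab : a ≠ b) :
    -- `n² ≤ σ(Σ*uΣ*) ≤ 1.5 n² + o(n²)` for every word `u` of length `n`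
    (∀ u : List α, u.length ^ 2 ≤ syntacticComplexity (principalIdealLanguage u)) ∧
    (∃ f : ℕ → ℝ, f =o[atTop] (fun n : ℕ => (n : ℝ) ^ 2) ∧
      ∀ u : List α, (syntacticComplexity (principalIdealLanguage u) : ℝ) ≤
        1.5 * (u.length : ℝ) ^ 2 + f u.length) ∧
    -- the words `a b² a³ b⁴ ⋯ a^(k-1) b^k` and their padded variants attain the upper bound
    ∃ w : ℕ → List α,
      (∀ n, (w n).length = n) ∧
      (∀ k, Even k → w (k * (k + 1) / 2) = alternatingBlocks a b k) ∧
      (∀ k l, Even k → 1 ≤ l → l ≤ k + 1 →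
        w (k * (k + 1) / 2 + l) = alternatingBlocks a b k ++ List.replicate l a) ∧
      (∀ k r, Even k → 1 ≤ r → r ≤ k + 1 →
        w ((k + 1) * (k + 2) / 2 + r) =
          alternatingBlocks a b k ++ List.replicate (k + 1) a ++ List.replicate r b) ∧
      (fun n : ℕ => (syntacticComplexity (principalIdealLanguage (w n)) : ℝ)
          - 1.5 * (n : ℝ) ^ 2) =o[atTop] (fun n : ℕ => (n : ℝ) ^ 2) := by
  have : Nontrivial α := ⟨a, b, hab⟩
  refine ⟨sq_le_syntacticComplexity, ⟨_, isLittleO_natCast_succ, syntacticComplexity_le_real⟩,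
    blockWord a b, length_blockWord, fun k _ => blockWord_triangular k, ?_, ?_,
    isLittleO_syntacticComplexity_blockWord hab⟩
  · intro k l hk _ hl
    rw [← blockWord_triangular]
    exact (blockWord_triangular_add hl).trans (by rw [if_pos hk])
  · intro k r hk _ hr
    have h := blockWord_triangular_add (a := a) (b := b) (k := k + 1) (l := r) (by omega)
    rw [if_neg (by simpa [Nat.even_add_one] using hk), blockWord_triangular, alternatingBlocks,
      if_pos hk] at h
    exact h
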